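/- **Setting.** Let $\mathcal O$ be a Dedekind domain, $\mathfrak p$ a nonzero prime ideal of $\mathcal O$ with finite residue field of cardinality $q$, and $R$ an $\mathcal O$-algebra that is a discrete valuation ring. Let $\pi\in R$ be a nonzero generator of $\mathfrak pR$ such that $R$ is $\pi$-adically complete, and let $\phi:R\to R$ be a ring endomorphism with $\phi(\pi)=\pi$ and $\phi(x)\equiv x^q \bmod \pi$ for all $x\in R$. (The condition $\phi(\pi)=\pi$ holds if $\phi$ is $\mathcal O$-linear and $\pi$ comes from a uniformizer of $\mathcal O$ at $\mathfrak p$.) Put $S=\operatorname{Spf}R$. All formal spectra are taken for the $\pi$-adic topology. A $\pi$-formal scheme is a locally ringed space over $S$ that is locally of the form $\operatorname{Spf}A$ with $A$ a $\pi$-adically complete $R$-algebra; for an $R$-algebra $B$ write $X(B)=\operatorname{Hom}_S(\operatorname{Spf}B,X)$. For $i\ge 0$ let $B^{\phi^i}$ be the ring $B$ with structure map $R\xrightarrow{\phi^i}R\to B$, and let $X^{\phi^i}(B)=X(B^{\phi^i})$. **Witt vectors.** $W_n(B)$ denotes the $R$-algebra of $\pi$-typical Witt vectors $(x_0,\dots,x_n)$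 with entries in $B$; its ghost components $$w_i:W_n(B)\to B^{\phi^i},\qquad w_i=x_0^{q^i}+\pi x_1^{q^{i-1}}+\cdots+\pi^i x_i\quad(0\le i\le n)$$ are homomorphisms of $R$-algebras. $F:W_{n+1}(B)\to W_n(B^\phi)$ is the Frobenius, with $w_i\circ F=w_{i+1}$. The map $\exp_\delta:R\to W_n(R)$ is the ring homomorphism with $w_i\circ\exp_\delta=\phi^i$. **Jet spaces and kernels.** Formal schemes over $S$ are described by their functors of points on $\pi$-adically complete $R$-algebras $B$; a morphism $Y\to Z$ over $\phi:S\to S$ is a family of maps $Y(B)\to Z(B^\phi)$ natural in $B$. Let $X$ be a $\pi$-formal scheme with a marked point $P\in X(R)$. The jet spaces are $J^nX(B)=X(W_n(B))$, with projections $u_m:J^{m+n}X\to J^mX$ induced by truncation and marked points $P^n=P\circ\operatorname{Spf}(\exp_\delta)\in J^nX(R)$. Put $$N^{[m]n}X=J^{m+n}X\times_{u_m,\,J^mX,\,P^m}S .$$ The ghost components induce $w:J^nX\to\prod_\phi^nX=X\times_S X^\phi\times_S\cdots\times_S X^{\phi^n}$. Let $\prod_{[m]n}X$ be the part of $\prod_\phi^{m+n}X$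 that consists of the points $\langle P,\dots,P,z_{m+1},\dots,z_{m+n}\rangle$, where $z_i\in X^{\phi^i}$ and the entry $P$ in place $i\le m$ is the pullback of $P$ to $X^{\phi^i}$. Then $w$ restricts to $w:N^{[m]n}X\to\prod_{[m]n}X$. **The maps.** Let $m\ge1$ and $n\ge0$. The Frobenius $\phi:J^{m+n}X\to J^{m+n-1}X$ over $\phi:S\to S$ that is induced by $F$ restricts to a morphism $$\Phi_{[m]}:N^{[m]n}X\to N^{[m-1]n}X\quad\text{over }\phi:S\to S.$$ Let $\phi_S:X^{\phi^{i}}\to X^{\phi^{i-1}}$ be the projection over $\phi:S\to S$, that is, on $B$-points the identification $X(B^{\phi^i})=X((B^\phi)^{\phi^{i-1}})$. Let $\Phi_{[m]w}:\prod_{[m]n}X\to\prod_{[m-1]n}X$ be the morphism over $\phi:S\to S$ given by $$\Phi_{[m]w}\langle \underbrace{P,\dots,P}_{m+1},z_{m+1},\dots,z_{m+n}\rangle=\langle\underbrace{\phi_S(P),\dots,\phi_S(P)}_{m},\phi_S(z_{m+1}),\dots,\phi_S(z_{m+n})\rangle .$$ **Claim.** For all $m\ge1$ and $n\ge0$, $$w\circ\Phi_{[m]}=\Phi_{[m]w}\circ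 w$$ as morphisms $N^{[m]n}X\to\prod_{[m-1]n}X$ over $\phi:S\to S$. Moreover, $\Phi_{[m]}$ is the morphism induced by the shifted Witt vectors. For an $R$-algebra homomorphism $f:A\to B$ let $W_{[m]n}(f)=W_m(A)\times_{W_m(B)}W_{m+n}(B)$, and let $N_{[m]n}(f)$ be the set of $g\in X(W_{[m]n}(f))$ whose image in $X(W_m(A))$ is the pullback of $P^m$. The second projection $W_{[m]n}(f)\to W_{m+n}(B)$ induces $\iota_m:N_{[m]n}(f)\to N^{[m]n}X(B)$. For $f:R\to B$ the structure map this is the usual ring $W_{[m]n}(B)=W_m(R)\times_{W_m(B)}W_{m+n}(B)$. Let $E_{[m]}:W_{[m]n}(f)\to W_{[m-1]n}(f^\phi)$ be the homomorphism given by $F$ on both factors, where $f^\phi$ is $f$ regarded as a homomorphism $A^\phi\to B^\phi$. Then for every $\pi$-adically complete $R$-algebra $B$, with structure map $f:R\to B$, and every $g\in N_{[m]n}(f)$, $$\Phi_{[m]}(\iota_m(g))=\iota_{m-1}\bigl(X(E_{[m]})(g)\bigr).$$ -/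

import Mathlib

open CategoryTheory AlgebraicGeometry TopologicalSpace Opposite

universe v u

/-! ## The base -/

/-- The arithmetic base: a Dedekind domain `O` with a nonzero prime ideal `𝔭` whose residue field is
finite, an `O`-algebra `R` that is a discrete valuation ring, a nonzero generator `π` of `𝔭R` such
that `R` is `π`-adically complete, and a lift of Frobenius `φ : R → R`, that is, a ring endomorphism
with `φ(π) = π` and `φ(x) ≡ x ^ q` modulo `π`, where `q = #(O/𝔭)`.
(If `π` is the image of a uniformizer of `O` at `𝔭` and `φ` is `O`-linear, then `φ(π) = π`.) -/
structure FrobeniusBase (O : Type v) (R : Type u) [CommRing O] [IsDedekindDomain O]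
    [CommRing R] [IsDomain R] [IsDiscreteValuationRing R] [Algebra O R] where
  /-- the prime `𝔭` -/
  prime : Ideal O
  isPrime : prime.IsPrime
  ne_bot : prime ≠ ⊥
  finite_residue : Finite (O ⧸ prime)
  /-- the uniformizer `π`, regarded in `R` -/
  π : R
  π_ne_zero : π ≠ 0
  span_π : Ideal.span {π} = prime.map (algebraMap O R)
  complete : IsAdicComplete (Ideal.span {π}) R
  /-- the lift of Frobenius `φ` -/
  φ : R →+* R
  φ_π : φ π = π
  φ_congr : ∀ x, φ x - x ^ Nat.card (O ⧸ prime) ∈ Ideal.span {π}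

noncomputable section

namespace FrobeniusBase

variable {O : Type v} {R : Type u} [CommRing O] [IsDedekindDomain O]
  [CommRing R] [IsDomain R] [IsDiscreteValuationRing R] [Algebra O R] (D : FrobeniusBase O R)

/-- The cardinality `q` of the residue field of `O` at `𝔭`. -/
def q : ℕ := Nat.card (O ⧸ D.prime)

/-- The image of `π` in an `R`-algebra. -/
def pi (A : Type u) [CommRing A] [Algebra R A] : A := algebraMap R A D.π

theorem exists_q : ∃ p h : ℕ, p.Prime ∧ h ≠ 0 ∧ D.q = p ^ h ∧ D.π ∣ (p : R) := by
  have := D.isPrime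
  have := D.finite_residue
  let _ : Field (O ⧸ D.prime) := (Finite.isField_of_domain (O ⧸ D.prime)).toField
  obtain ⟨p, hp⟩ := CharP.exists (O ⧸ D.prime)
  have : Fintype (O ⧸ D.prime) := Fintype.ofFinite _
  obtain ⟨n, hpr, hn⟩ := FiniteField.card (O ⧸ D.prime) p
  refine ⟨p, n, hpr, n.2.ne', ?_, ?_⟩
  · rw [q, Nat.card_eq_fintype_card, hn]
  · have h1 : (p : O) ∈ D.prime := by
      rw [← Ideal.Quotient.eq_zero_iff_mem, map_natCast]
      exact CharP.cast_eq_zero _ _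
    have h2 := Ideal.mem_map_of_mem (algebraMap O R) h1
    rw [← D.span_π, map_natCast] at h2
    exact Ideal.mem_span_singleton.mp h2

theorem pi_dvd_q (A : Type u) [CommRing A] [Algebra R A] : D.pi A ∣ (D.q : A) := by
  obtain ⟨p, h, -, hh, hq, hd⟩ := D.exists_q
  have := (map_dvd (algebraMap R A) hd)
  rw [map_natCast] at this
  rw [hq, Nat.cast_pow]
  exact this.trans (dvd_pow_self _ hh)

theorem q_ne_zero : D.q ≠ 0 := by
  obtain ⟨p, h, hp, hh, hq, hd⟩ := D.exists_q
  rw [hq]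
  exact pow_ne_zero _ hp.ne_zero

theorem pi_dvd_add_pow {A : Type u} [CommRing A] [Algebra R A] (a b : A) :
    D.pi A ∣ (a + b) ^ D.q - (a ^ D.q + b ^ D.q) := by
  obtain ⟨p, h, hp, hh, hq, hd⟩ := D.exists_q
  have := (map_dvd (algebraMap R A) hd)
  rw [map_natCast] at this
  obtain ⟨r, hr⟩ := exists_add_pow_prime_pow_eq hp a b h
  rw [hq, hr]
  refine this.trans ⟨a * b * r, ?_⟩
  ring

theorem dvd_pow_q_sub {A : Type u} [CommRing A] [Algebra R A] {a b : A} {i : ℕ}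
    (h : D.pi A ^ (i + 1) ∣ a - b) : D.pi A ^ (i + 2) ∣ a ^ D.q - b ^ D.q := by
  rw [← (Commute.all a b).geom_sum₂_mul D.q, pow_succ' _ (i + 1)]
  refine mul_dvd_mul ?_ h
  have h1 : D.pi A ∣ a - b := (dvd_pow_self _ (Nat.succ_ne_zero i)).trans h
  rw [← Ideal.mem_span_singleton, ← Ideal.Quotient.eq_zero_iff_mem] at h1 ⊢
  rw [map_sub, sub_eq_zero] at h1
  have h2 : (Ideal.Quotient.mk (Ideal.span {D.pi A})) (D.q : A) = 0 :=
    Ideal.Quotient.eq_zero_iff_mem.mpr (Ideal.mem_span_singleton.mpr (D.pi_dvd_q A))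
  rw [map_natCast] at h2
  simp only [map_sum, map_mul, map_pow, h1]
  rw [geom_sum₂_self, h2, zero_mul]

theorem dvd_pow_pow_sub {A : Type u} [CommRing A] [Algebra R A] {a b : A}
    (h : D.pi A ∣ a - b) (i : ℕ) : D.pi A ^ (i + 1) ∣ a ^ D.q ^ i - b ^ D.q ^ i := by
  induction i with
  | zero => simpa using h
  | succ i ih =>
    rw [pow_succ D.q, pow_mul, pow_mul]
    exact D.dvd_pow_q_sub ih

/-! ## Truncated `π`-typical Witt vectors -/

/-- The underlying set `B ^ (n + 1)` of the `π`-typical Witt vectors `W_n(B)` of length `n + 1`. -/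
def Witt (_ : FrobeniusBase O R) (n : ℕ) (B : Type u) : Type u := Fin (n + 1) → B

namespace Witt

variable {D} {n : ℕ} {A B C : Type u} [CommRing A] [Algebra R A] [CommRing B] [Algebra R B]
  [CommRing C] [Algebra R C]

/-- The coordinates `x_0, …, x_n`, continued by `0`. -/
def coeff (x : D.Witt n B) (j : ℕ) : B := if h : j < n + 1 then x ⟨j, h⟩ else 0

/-- The ghost components `w_i = x_0 ^ (q ^ i) + π x_1 ^ (q ^ (i - 1)) + ⋯ + π ^ i x_i`, for
`i ≤ n`. -/
def ghost (x : D.Witt n B) (i : Fin (n + 1)) : B :=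
  ∑ j ∈ Finset.range (i + 1), D.pi B ^ j * x.coeff j ^ D.q ^ ((i : ℕ) - j)

/-- The map of sets `W_n(f) : W_n(A) → W_n(B)`. -/
def mapFun (f : A →ₐ[R] B) (x : D.Witt n A) : D.Witt n B := fun i => f (x i)

theorem coeff_mapFun (f : A →ₐ[R] B) (x : D.Witt n A) (j : ℕ) :
    (mapFun f x).coeff j = f (x.coeff j) := by
  unfold coeff mapFun
  split <;> simp

theorem map_pi (f : A →ₐ[R] B) : f (D.pi A) = D.pi B := f.commutes D.π

theorem ghost_mapFun (f : A →ₐ[R] B) (x : D.Witt n A) (i : Fin (n + 1)) :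
    (mapFun f x).ghost i = f (x.ghost i) := by
  simp [ghost, coeff_mapFun, map_pi]

/-- `A` has no `π`-torsion. -/
def TorsionFree (D : FrobeniusBase O R) (A : Type u) [CommRing A] [Algebra R A] : Prop :=
  ∀ a : A, D.pi A * a = 0 → a = 0

theorem TorsionFree.pow (hA : TorsionFree D A) (k : ℕ) (a b : A)
    (h : D.pi A ^ k * a = D.pi A ^ k * b) : a = b := by
  induction k with
  | zero => simpa using h
  | succ k ih =>
    apply ih
    rw [pow_succ', mul_assoc, mul_assoc, ← sub_eq_zero, ← mul_sub] at h
    exact sub_eq_zero.mp (hA _ h)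

theorem ghost_injective (hA : TorsionFree D A) {x y : D.Witt n A}
    (h : ∀ i, x.ghost i = y.ghost i) : x = y := by
  have key : ∀ i : ℕ, ∀ hi : i < n + 1, x ⟨i, hi⟩ = y ⟨i, hi⟩ := by
    intro i
    induction i using Nat.strong_induction_on with
    | _ i ih =>
      intro hi
      have hi' := h ⟨i, hi⟩
      simp only [ghost] at hi'
      rw [Finset.sum_range_succ, Finset.sum_range_succ] at hi'
      have : ∀ j ∈ Finset.range i, D.pi A ^ j * x.coeff j ^ D.q ^ (i - j) =
          D.pi A ^ j * y.coeff j ^ D.q ^ (i - j) := by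
        intro j hj
        have hji := Finset.mem_range.mp hj
        simp only [coeff, dif_pos (hji.trans hi), ih j hji]
      rw [Finset.sum_congr rfl this] at hi'
      have h3 := add_left_cancel hi'
      simp only [Nat.sub_self, pow_zero, pow_one, coeff, dif_pos hi] at h3
      exact hA.pow _ _ _ h3
  funext i
  exact key i i.2

/-- A lift of Frobenius on an `R`-algebra fixing `π`. -/
structure IsLift (D : FrobeniusBase O R) (ψ : A →+* A) : Prop where
  map_pi : ψ (D.pi A) = D.pi A
  congr : ∀ a, D.pi A ∣ ψ a - a ^ D.q

/-- Dwork's criterion. -/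
theorem exists_ghost_iff {ψ : A →+* A} (hψ : IsLift D ψ) (z : Fin (n + 1) → A) :
    (∃ x : D.Witt n A, ∀ i, x.ghost i = z i) ↔
      ∀ (i : ℕ) (hi : i + 1 < n + 1),
        D.pi A ^ (i + 1) ∣ z ⟨i + 1, hi⟩ - ψ (z ⟨i, Nat.lt_of_succ_lt hi⟩) := by
  have key : ∀ (c : ℕ → A) (i : ℕ), D.pi A ^ (i + 1) ∣
      (∑ j ∈ Finset.range (i + 1), D.pi A ^ j * c j ^ D.q ^ (i + 1 - j)) -
        ψ (∑ j ∈ Finset.range (i + 1), D.pi A ^ j * c j ^ D.q ^ (i - j)) := by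
    intro c i
    rw [map_sum, ← Finset.sum_sub_distrib]
    refine Finset.dvd_sum fun j hj => ?_
    have hj' : j ≤ i := Nat.lt_succ_iff.mp (Finset.mem_range.mp hj)
    rw [map_mul, map_pow, map_pow, hψ.map_pi, ← mul_sub]
    obtain ⟨k, rfl⟩ := Nat.exists_eq_add_of_le hj'
    have e1 : j + k + 1 - j = 1 + k := by omega
    have e2 : j + k - j = k := by omega
    rw [e1, e2, pow_add D.q, pow_one, pow_mul, add_assoc, pow_add]
    refine mul_dvd_mul_left _ (D.dvd_pow_pow_sub ?_ k)
    rw [← dvd_neg, neg_sub]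
    exact hψ.congr _
  constructor
  · rintro ⟨x, hx⟩ i hi
    rw [← hx, ← hx]
    simp only [ghost]
    rw [Finset.sum_range_succ, add_sub_right_comm]
    exact dvd_add (key _ _) (Dvd.intro _ rfl)
  · intro hz
    have : ∀ k, k < n + 1 → ∃ c : ℕ → A, ∀ i (hi : i < n + 1), i ≤ k →
        ∑ j ∈ Finset.range (i + 1), D.pi A ^ j * c j ^ D.q ^ (i - j) = z ⟨i, hi⟩ := by
      intro k hk
      induction k with
      | zero =>
        refine ⟨fun _ => z ⟨0, hk⟩, fun i hi h0 => ?_⟩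
        obtain rfl : i = 0 := by omega
        simp
      | succ k ih =>
        obtain ⟨c, hc⟩ := ih (by omega)
        have h1 := hz k hk
        rw [← hc k (by omega) le_rfl] at h1
        obtain ⟨d, hd⟩ := dvd_sub h1 (key c k)
        have hne : ∀ i ≤ k, ∀ e : ℕ → ℕ,
            ∑ j ∈ Finset.range (i + 1), D.pi A ^ j * Function.update c (k + 1) d j ^ e j =
            ∑ j ∈ Finset.range (i + 1), D.pi A ^ j * c j ^ e j := by
          intro i hi e
          refine Finset.sum_congr rfl fun j hj => ?_
          have := Finset.mem_range.mp hj
          rw [Function.update_of_ne (by omega)]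
        refine ⟨Function.update c (k + 1) d, fun i hi hik => ?_⟩
        rcases Nat.lt_or_eq_of_le hik with h | rfl
        · rw [hne i (by omega), hc i hi (by omega)]
        · rw [Finset.sum_range_succ, hne k le_rfl]
          simp only [Function.update_self, Nat.sub_self, pow_zero, pow_one]
          rw [← hd]
          ring
    obtain ⟨c, hc⟩ := this n (by omega)
    refine ⟨fun i => c i, fun i => ?_⟩
    rw [← hc i i.2 (by omega)]
    refine Finset.sum_congr rfl fun j hj => ?_
    have h1 := Finset.mem_range.mp hj
    have h2 : j < n + 1 := by omega
    simp only [coeff, dif_pos h2]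

theorem torsionFree_base : TorsionFree D R := by
  intro a ha
  rcases mul_eq_zero.mp ha with h | h
  · exact absurd h D.π_ne_zero
  · exact h

theorem isLift_φ : IsLift D D.φ where
  map_pi := D.φ_π
  congr a := Ideal.mem_span_singleton.mp (D.φ_congr a)

theorem torsionFree_poly (σ : Type u) : TorsionFree D (MvPolynomial σ R) := by
  intro a ha
  rcases mul_eq_zero.mp ha with h | h
  · exact absurd ((map_eq_zero_iff _ (MvPolynomial.C_injective σ R)).mp h) D.π_ne_zero
  · exact h

/-- The lift of Frobenius on a polynomial ring that raises the variables to the power `q`. -/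
def polyLift (D : FrobeniusBase O R) (σ : Type u) : MvPolynomial σ R →+* MvPolynomial σ R :=
  MvPolynomial.eval₂Hom (MvPolynomial.C.comp D.φ) fun s => MvPolynomial.X s ^ D.q

theorem isLift_polyLift (σ : Type u) : IsLift D (polyLift D σ) where
  map_pi := by
    change polyLift D σ (MvPolynomial.C D.π) = MvPolynomial.C D.π
    simp [polyLift, D.φ_π]
  congr a := by
    induction a using MvPolynomial.induction_on with
    | C a =>
      have := map_dvd (MvPolynomial.C (σ := σ)) (Ideal.mem_span_singleton.mp (D.φ_congr a))
      simpa [polyLift, pi, MvPolynomial.algebraMap_eq, q] using this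
    | add a b ha hb =>
      have := dvd_sub (dvd_add ha hb) (D.pi_dvd_add_pow a b)
      convert this using 1
      rw [map_add]
      ring
    | mul_X a s ha =>
      have e : polyLift D σ (MvPolynomial.X s) = MvPolynomial.X s ^ D.q := by simp [polyLift]
      rw [map_mul, mul_pow, e, ← sub_mul]
      exact Dvd.dvd.mul_right ha _

/-- A polynomial combination of ghost vectors is a ghost vector. -/
theorem exists_binary {ψ : A →+* A} (hψ : IsLift D ψ) (x y : D.Witt n A)
    (g : A → A → A) (hg : ∀ a b, ψ (g a b) = g (ψ a) (ψ b))
    (hd : ∀ (m a b c d : A), m ∣ a - c → m ∣ b - d → m ∣ g a b - g c d) :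
    ∃ s : D.Witt n A, ∀ i, s.ghost i = g (x.ghost i) (y.ghost i) := by
  refine (exists_ghost_iff hψ (fun i => g (x.ghost i) (y.ghost i))).mpr fun i hi => ?_
  rw [hg]
  exact hd _ _ _ _ _ ((exists_ghost_iff hψ x.ghost).mp ⟨x, fun _ => rfl⟩ i hi)
    ((exists_ghost_iff hψ y.ghost).mp ⟨y, fun _ => rfl⟩ i hi)

/-- Index set of two generic Witt vectors of length `n + 1`. -/
abbrev Idx (n : ℕ) : Type u := ULift.{u} (Fin (n + 1) ⊕ Fin (n + 1))

/-- The first generic Witt vector. -/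
def genX (D : FrobeniusBase O R) (n : ℕ) : D.Witt n (MvPolynomial (Idx.{u} n) R) :=
  fun i => MvPolynomial.X ⟨Sum.inl i⟩

/-- The second generic Witt vector. -/
def genY (D : FrobeniusBase O R) (n : ℕ) : D.Witt n (MvPolynomial (Idx.{u} n) R) :=
  fun i => MvPolynomial.X ⟨Sum.inr i⟩

theorem exists_addPoly (D : FrobeniusBase O R) (n : ℕ) :
    ∃ s : D.Witt n (MvPolynomial (Idx.{u} n) R),
      ∀ i, s.ghost i = (genX D n).ghost i + (genY D n).ghost i :=
  exists_binary (isLift_polyLift _) _ _ (· + ·) (map_add _) fun m a b c d h1 h2 => by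
    have := dvd_add h1 h2
    rwa [← add_sub_add_comm] at this

theorem exists_mulPoly (D : FrobeniusBase O R) (n : ℕ) :
    ∃ s : D.Witt n (MvPolynomial (Idx.{u} n) R),
      ∀ i, s.ghost i = (genX D n).ghost i * (genY D n).ghost i :=
  exists_binary (isLift_polyLift _) _ _ (· * ·) (map_mul _) fun m a b c d h1 h2 => by
    have := dvd_add (h1.mul_right b) (h2.mul_left c)
    convert this using 1
    ring

theorem exists_negPoly (D : FrobeniusBase O R) (n : ℕ) :
    ∃ s : D.Witt n (MvPolynomial (Idx.{u} n) R), ∀ i, s.ghost i = -(genX D n).ghost i :=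
  exists_binary (isLift_polyLift _) _ (genX D n) (fun a _ => -a) (fun a _ => map_neg _ a)
    fun m a b c d h1 _ => by
      have := h1.neg_right
      convert this using 1
      ring

/-- The unique polynomials giving the addition of Witt vectors. -/
def addPoly (D : FrobeniusBase O R) (n : ℕ) : D.Witt n (MvPolynomial (Idx.{u} n) R) :=
  (exists_addPoly D n).choose

/-- The unique polynomials giving the multiplication of Witt vectors. -/
def mulPoly (D : FrobeniusBase O R) (n : ℕ) : D.Witt n (MvPolynomial (Idx.{u} n) R) :=
  (exists_mulPoly D n).choose

/-- The unique polynomials giving the additive inverse of Witt vectors. -/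
def negPoly (D : FrobeniusBase O R) (n : ℕ) : D.Witt n (MvPolynomial (Idx.{u} n) R) :=
  (exists_negPoly D n).choose

/-- Evaluation of polynomials at a pair of Witt vectors. -/
def evalAt (x y : D.Witt n B) : MvPolynomial (Idx.{u} n) R →ₐ[R] B :=
  MvPolynomial.aeval fun s => Sum.elim x y s.down

theorem evalAt_comp (f : A →ₐ[R] B) (x y : D.Witt n A) :
    f.comp (evalAt x y) = evalAt (mapFun f x) (mapFun f y) := by
  apply MvPolynomial.algHom_ext
  rintro ⟨i | i⟩ <;> simp [evalAt] <;> rfl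

theorem mapFun_genX (x y : D.Witt n B) : mapFun (evalAt x y) (genX D n) = x := by
  funext i
  simp only [mapFun, evalAt, genX, MvPolynomial.aeval_X]
  rfl

theorem mapFun_genY (x y : D.Witt n B) : mapFun (evalAt x y) (genY D n) = y := by
  funext i
  simp only [mapFun, evalAt, genY, MvPolynomial.aeval_X]
  rfl

instance : Zero (D.Witt n B) := ⟨fun _ => 0⟩
instance : One (D.Witt n B) := ⟨fun i => if i = 0 then 1 else 0⟩
instance : Add (D.Witt n B) := ⟨fun x y => mapFun (evalAt x y) (addPoly D n)⟩
instance : Mul (D.Witt n B) := ⟨fun x y => mapFun (evalAt x y) (mulPoly D n)⟩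
instance : Neg (D.Witt n B) := ⟨fun x => mapFun (evalAt x x) (negPoly D n)⟩

theorem ghost_zero (i : Fin (n + 1)) : (0 : D.Witt n B).ghost i = 0 := by
  refine Finset.sum_eq_zero fun j hj => ?_
  have : (0 : D.Witt n B).coeff j = 0 := by
    unfold coeff
    split <;> rfl
  rw [this, zero_pow (pow_ne_zero _ D.q_ne_zero), mul_zero]

theorem ghost_one (i : Fin (n + 1)) : (1 : D.Witt n B).ghost i = 1 := by
  have h0 : (1 : D.Witt n B).coeff 0 = 1 := by
    unfold coeff
    rw [dif_pos (Nat.succ_pos n)]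
    rfl
  have h1 : ∀ j, j ≠ 0 → (1 : D.Witt n B).coeff j = 0 := by
    intro j hj
    unfold coeff
    split
    · rename_i h
      have : (⟨j, h⟩ : Fin (n + 1)) ≠ 0 := by
        intro h2
        exact hj (congrArg Fin.val h2)
      exact if_neg this
    · rfl
  unfold ghost
  rw [Finset.sum_eq_single 0]
  · simp [h0]
  · intro j _ hj
    rw [h1 j hj, zero_pow (pow_ne_zero _ D.q_ne_zero), mul_zero]
  · simp

theorem ghost_add (x y : D.Witt n B) (i : Fin (n + 1)) :
    (x + y).ghost i = x.ghost i + y.ghost i := by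
  change (mapFun (evalAt x y) (addPoly D n)).ghost i = _
  rw [ghost_mapFun, addPoly, (exists_addPoly D n).choose_spec, map_add, ← ghost_mapFun,
    ← ghost_mapFun, mapFun_genX, mapFun_genY]

theorem ghost_mul (x y : D.Witt n B) (i : Fin (n + 1)) :
    (x * y).ghost i = x.ghost i * y.ghost i := by
  change (mapFun (evalAt x y) (mulPoly D n)).ghost i = _
  rw [ghost_mapFun, mulPoly, (exists_mulPoly D n).choose_spec, map_mul, ← ghost_mapFun,
    ← ghost_mapFun, mapFun_genX, mapFun_genY]

theorem ghost_neg (x : D.Witt n B) (i : Fin (n + 1)) : (-x).ghost i = -x.ghost i := by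
  change (mapFun (evalAt x x) (negPoly D n)).ghost i = _
  rw [ghost_mapFun, negPoly, (exists_negPoly D n).choose_spec, map_neg, ← ghost_mapFun,
    mapFun_genX]

theorem mapFun_comp (f : A →ₐ[R] B) (g : B →ₐ[R] C) (x : D.Witt n A) :
    mapFun g (mapFun f x) = mapFun (g.comp f) x := rfl

theorem mapFun_zero (f : A →ₐ[R] B) : mapFun f (0 : D.Witt n A) = 0 := by
  funext i
  exact map_zero f

theorem mapFun_one (f : A →ₐ[R] B) : mapFun f (1 : D.Witt n A) = 1 := by
  funext i
  change f (if i = 0 then 1 else 0) = if i = 0 then 1 else 0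
  split <;> simp

theorem mapFun_add (f : A →ₐ[R] B) (x y : D.Witt n A) :
    mapFun f (x + y) = mapFun f x + mapFun f y := by
  change mapFun f (mapFun (evalAt x y) _) = mapFun (evalAt _ _) _
  rw [mapFun_comp, evalAt_comp]

theorem mapFun_mul (f : A →ₐ[R] B) (x y : D.Witt n A) :
    mapFun f (x * y) = mapFun f x * mapFun f y := by
  change mapFun f (mapFun (evalAt x y) _) = mapFun (evalAt _ _) _
  rw [mapFun_comp, evalAt_comp]

theorem mapFun_neg (f : A →ₐ[R] B) (x : D.Witt n A) : mapFun f (-x) = -mapFun f x := by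
  change mapFun f (mapFun (evalAt x x) _) = mapFun (evalAt _ _) _
  rw [mapFun_comp, evalAt_comp]

/-- The polynomial ring over `R` on the elements of `B`, mapped onto `B`. -/
def cover (B : Type u) [CommRing B] [Algebra R B] : MvPolynomial B R →ₐ[R] B :=
  MvPolynomial.aeval id

theorem mapFun_cover_surjective (x : D.Witt n B) : ∃ y, mapFun (cover B) y = x :=
  ⟨fun i => MvPolynomial.X (x i), by
    funext i
    simp [mapFun, cover]⟩

theorem poly_ext {σ : Type u} {x y : D.Witt n (MvPolynomial σ R)}
    (h : ∀ i, x.ghost i = y.ghost i) : x = y :=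
  ghost_injective (torsionFree_poly σ) h

/-- The ring `W_n(B)`: the functorial ring structure for which the ghost components are ring
homomorphisms. -/
instance : CommRing (D.Witt n B) :=
  CommRing.ofMinimalAxioms
    (by
      intro x y z
      obtain ⟨x, rfl⟩ := mapFun_cover_surjective x
      obtain ⟨y, rfl⟩ := mapFun_cover_surjective y
      obtain ⟨z, rfl⟩ := mapFun_cover_surjective z
      simp only [← mapFun_add]
      exact congrArg _ (poly_ext fun i => by simp only [ghost_add, add_assoc]))
    (by
      intro x
      obtain ⟨x, rfl⟩ := mapFun_cover_surjective x
      rw [← mapFun_zero (cover B), ← mapFun_add]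
      exact congrArg _ (poly_ext fun i => by simp only [ghost_add, ghost_zero, zero_add]))
    (by
      intro x
      obtain ⟨x, rfl⟩ := mapFun_cover_surjective x
      rw [← mapFun_neg, ← mapFun_zero (cover B), ← mapFun_add]
      exact congrArg _ (poly_ext fun i => by
        simp only [ghost_add, ghost_neg, ghost_zero, neg_add_cancel]))
    (by
      intro x y z
      obtain ⟨x, rfl⟩ := mapFun_cover_surjective x
      obtain ⟨y, rfl⟩ := mapFun_cover_surjective y
      obtain ⟨z, rfl⟩ := mapFun_cover_surjective z
      simp only [← mapFun_mul]
      exact congrArg _ (poly_ext fun i => by simp only [ghost_mul, mul_assoc]))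
    (by
      intro x y
      obtain ⟨x, rfl⟩ := mapFun_cover_surjective x
      obtain ⟨y, rfl⟩ := mapFun_cover_surjective y
      simp only [← mapFun_mul]
      exact congrArg _ (poly_ext fun i => by simp only [ghost_mul, mul_comm]))
    (by
      intro x
      obtain ⟨x, rfl⟩ := mapFun_cover_surjective x
      rw [← mapFun_one (cover B), ← mapFun_mul]
      exact congrArg _ (poly_ext fun i => by simp only [ghost_mul, ghost_one, one_mul]))
    (by
      intro x y z
      obtain ⟨x, rfl⟩ := mapFun_cover_surjective x
      obtain ⟨y, rfl⟩ := mapFun_cover_surjective y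
      obtain ⟨z, rfl⟩ := mapFun_cover_surjective z
      simp only [← mapFun_mul, ← mapFun_add]
      exact congrArg _ (poly_ext fun i => by simp only [ghost_mul, ghost_add, mul_add]))

/-- `W_n(f)` as a ring homomorphism. -/
def mapRing (f : A →ₐ[R] B) : D.Witt n A →+* D.Witt n B where
  toFun := mapFun f
  map_zero' := mapFun_zero f
  map_one' := mapFun_one f
  map_add' := mapFun_add f
  map_mul' := mapFun_mul f

theorem exists_exp (D : FrobeniusBase O R) (n : ℕ) (r : R) :
    ∃ x : D.Witt n R, ∀ i, x.ghost i = (D.φ ^ (i : ℕ)) r := by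
  refine (exists_ghost_iff isLift_φ (fun i => (D.φ ^ (i : ℕ)) r)).mpr fun i hi => ?_
  have : (D.φ ^ (i + 1)) r = D.φ ((D.φ ^ i) r) := by
    rw [pow_succ']
    rfl
  simp [this]

/-- `exp_δ(r) ∈ W_n(R)`, the Witt vector with ghost components `r, φ(r), …, φ^n(r)`. -/
def expFun (D : FrobeniusBase O R) (n : ℕ) (r : R) : D.Witt n R := (exists_exp D n r).choose

theorem ghost_expFun (r : R) (i : Fin (n + 1)) :
    (expFun D n r).ghost i = (D.φ ^ (i : ℕ)) r := (exists_exp D n r).choose_spec i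

/-- The ring homomorphism `exp_δ : R → W_n(R)`. -/
def expRing (D : FrobeniusBase O R) (n : ℕ) : R →+* D.Witt n R where
  toFun := expFun D n
  map_zero' := ghost_injective torsionFree_base fun i => by simp [ghost_expFun, ghost_zero]
  map_one' := ghost_injective torsionFree_base fun i => by simp [ghost_expFun, ghost_one]
  map_add' x y := ghost_injective torsionFree_base fun i => by simp [ghost_expFun, ghost_add]
  map_mul' x y := ghost_injective torsionFree_base fun i => by simp [ghost_expFun, ghost_mul]

/-- The `R`-algebra structure of `W_n(B)`. -/
instance : Algebra R (D.Witt n B) :=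
  ((mapRing (Algebra.ofId R B)).comp (expRing D n)).toAlgebra

theorem algebraMap_eq (r : R) :
    algebraMap R (D.Witt n B) r = mapFun (Algebra.ofId R B) (expFun D n r) := rfl

/-- `W_n(f) : W_n(A) → W_n(B)`. -/
def map (f : A →ₐ[R] B) : D.Witt n A →ₐ[R] D.Witt n B where
  __ := mapRing f
  commutes' r := by
    change mapFun f (mapFun _ _) = mapFun _ _
    rw [mapFun_comp]
    congr 1
    exact Subsingleton.elim _ _

/-- The universal map `exp_δ : R → W_n(R)`. -/
def exp (D : FrobeniusBase O R) (n : ℕ) : R →ₐ[R] D.Witt n R where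
  __ := expRing D n
  commutes' r := by
    refine (funext fun i => ?_ : _ = mapFun (Algebra.ofId R R) (expFun D n r))
    rfl

end Witt

/-! ## Twists of `R`-algebras -/

/-- The `R`-algebra `B^{φ^i}`: the ring `B` with structure map `R → R → B`, the first map being
`φ^i`. -/
def Twist (_ : FrobeniusBase O R) (_ : ℕ) (B : Type u) : Type u := B

namespace Twist

variable {D} {A B C : Type u} [CommRing A] [Algebra R A] [CommRing B] [Algebra R B]

instance (i : ℕ) : CommRing (D.Twist i B) := inferInstanceAs (CommRing B)

instance (i : ℕ) : Algebra R (D.Twist i B) :=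
  RingHom.toAlgebra (S := D.Twist i B) ((algebraMap R B).comp (D.φ ^ i))

theorem algebraMap_eq (i : ℕ) (r : R) :
    algebraMap R (D.Twist i B) r = algebraMap R B ((D.φ ^ i) r) := rfl

/-- A homomorphism `f : A → B` as a homomorphism `A^{φ^i} → B^{φ^i}`. -/
def map (i : ℕ) (f : A →ₐ[R] B) : D.Twist i A →ₐ[R] D.Twist i B where
  __ := (f : A →+* B)
  commutes' _ := f.commutes _

/-- The identity map `B^{φ^(i+1)} → (B^φ)^{φ^i}`. -/
def shift (D : FrobeniusBase O R) (i : ℕ) (B : Type u) [CommRing B] [Algebra R B] :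
    D.Twist (i + 1) B →ₐ[R] D.Twist i (D.Twist 1 B) where
  __ := RingHom.id B
  commutes' r := by
    change algebraMap R B ((D.φ ^ (i + 1)) r) = algebraMap R B ((D.φ ^ 1) ((D.φ ^ i) r))
    rw [pow_succ', pow_one]
    rfl

theorem φ_pow_π (i : ℕ) : (D.φ ^ i) D.π = D.π := by
  induction i with
  | zero => rfl
  | succ i ih =>
    rw [pow_succ']
    change D.φ ((D.φ ^ i) D.π) = _
    rw [ih, D.φ_π]

theorem pi_eq (i : ℕ) : D.pi (D.Twist i B) = D.pi B :=
  congrArg (algebraMap R B) (φ_pow_π i)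

end Twist

namespace Witt

variable {D} {n : ℕ} {A B C : Type u} [CommRing A] [Algebra R A] [CommRing B] [Algebra R B]
  [CommRing C] [Algebra R C]

/-- The `i`-th component `W_n(B) → B^{φ^i}` of the ghost map `W_n(B) → B × B^φ × ⋯ × B^{φ^n}`. -/
def ghostHom (D : FrobeniusBase O R) (n : ℕ) (B : Type u) [CommRing B] [Algebra R B]
    (i : Fin (n + 1)) : D.Witt n B →ₐ[R] D.Twist i B where
  toFun x := x.ghost i
  map_zero' := ghost_zero (B := B) i
  map_one' := ghost_one (B := B) i
  map_add' x y := ghost_add x y i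
  map_mul' x y := ghost_mul x y i
  commutes' r := by
    rw [algebraMap_eq, ghost_mapFun, ghost_expFun]
    rfl

/-- The truncation of Witt vectors, on sets. -/
def truncFun {m : ℕ} (h : m ≤ n) (x : D.Witt n B) : D.Witt m B :=
  fun i => x (Fin.castLE (Nat.succ_le_succ h) i)

theorem ghost_truncFun {m : ℕ} (h : m ≤ n) (x : D.Witt n B) (i : Fin (m + 1)) :
    (truncFun h x).ghost i = x.ghost (Fin.castLE (Nat.succ_le_succ h) i) := by
  refine Finset.sum_congr rfl fun j hj => ?_
  have h1 : j < (i : ℕ) + 1 := Finset.mem_range.mp hj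
  have h2 : j < m + 1 := by omega
  have h3 : j < n + 1 := h2.trans_le (Nat.succ_le_succ h)
  have : (truncFun h x).coeff j = x.coeff j := by
    simp only [coeff, dif_pos h2, dif_pos h3]
    rfl
  rw [this]
  rfl

theorem truncFun_mapFun {m : ℕ} (h : m ≤ n) (f : A →ₐ[R] B) (x : D.Witt n A) :
    truncFun h (mapFun f x) = mapFun f (truncFun h x) := rfl

/-- The truncation map `T : W_n(B) → W_m(B)`, `(x_0, …, x_n) ↦ (x_0, …, x_m)`, for `m ≤ n`. -/
def trunc (D : FrobeniusBase O R) {m n : ℕ} (h : m ≤ n) (B : Type u) [CommRing B] [Algebra R B] :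
    D.Witt n B →ₐ[R] D.Witt m B where
  toFun := truncFun h
  map_zero' := rfl
  map_one' := by
    funext i
    change (if Fin.castLE (Nat.succ_le_succ h) i = 0 then (1 : B) else 0) = if i = 0 then 1 else 0
    exact if_congr (by rw [Fin.ext_iff, Fin.ext_iff]; rfl) rfl rfl
  map_add' x y := by
    obtain ⟨x, rfl⟩ := mapFun_cover_surjective x
    obtain ⟨y, rfl⟩ := mapFun_cover_surjective y
    simp only [← mapFun_add, truncFun_mapFun]
    exact congrArg _ (poly_ext fun i => by simp only [ghost_add, ghost_truncFun])
  map_mul' x y := by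
    obtain ⟨x, rfl⟩ := mapFun_cover_surjective x
    obtain ⟨y, rfl⟩ := mapFun_cover_surjective y
    simp only [← mapFun_mul, truncFun_mapFun]
    exact congrArg _ (poly_ext fun i => by simp only [ghost_mul, ghost_truncFun])
  commutes' r := by
    change truncFun h (mapFun _ _) = mapFun _ _
    rw [truncFun_mapFun]
    exact congrArg _ (ghost_injective torsionFree_base fun i =>
      (ghost_truncFun h _ i).trans ((ghost_expFun r _).trans (ghost_expFun r i).symm))

/-! ### The Witt vector Frobenius -/

theorem exists_frobPoly (D : FrobeniusBase O R) (n : ℕ) :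
    ∃ s : D.Witt n (MvPolynomial (Idx.{u} (n + 1)) R),
      ∀ i, s.ghost i = (genX D (n + 1)).ghost i.succ := by
  refine (exists_ghost_iff (isLift_polyLift _)
    (fun i => (genX D (n + 1)).ghost i.succ)).mpr fun i hi => ?_
  have := (exists_ghost_iff (isLift_polyLift _) (genX D (n + 1)).ghost).mp ⟨_, fun _ => rfl⟩
    (i + 1) (by omega)
  exact (pow_dvd_pow _ (Nat.le_succ _)).trans this

/-- The unique polynomials `F_0, …, F_n` in `x_0, …, x_{n+1}` giving the Frobenius. -/
def frobPoly (D : FrobeniusBase O R) (n : ℕ) : D.Witt n (MvPolynomial (Idx.{u} (n + 1)) R) :=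
  (exists_frobPoly D n).choose

/-- The Frobenius on Witt vectors, on sets. -/
def frobFun (x : D.Witt (n + 1) B) : D.Witt n (D.Twist 1 B) :=
  fun i => evalAt x x (frobPoly D n i)

theorem ghost_twist (x : D.Witt n B) (i : Fin (n + 1)) :
    ghost (D := D) (n := n) (B := D.Twist 1 B) x i = x.ghost i := by
  have := Twist.pi_eq (D := D) (B := B) 1
  unfold ghost
  rw [this]
  rfl

theorem ghost_frobFun (x : D.Witt (n + 1) B) (i : Fin (n + 1)) :
    (frobFun x).ghost i = x.ghost i.succ := by
  refine (ghost_twist (mapFun (evalAt x x) (frobPoly D n)) i).trans ?_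
  rw [ghost_mapFun, frobPoly, (exists_frobPoly D n).choose_spec, ← ghost_mapFun, mapFun_genX]

theorem frobFun_mapFun (f : A →ₐ[R] B) (x : D.Witt (n + 1) A) :
    frobFun (mapFun f x) = mapFun (Twist.map 1 f) (frobFun x) := by
  funext i
  change evalAt (mapFun f x) (mapFun f x) (frobPoly D n i) = f (evalAt x x (frobPoly D n i))
  rw [← evalAt_comp]
  rfl

theorem torsionFree_twist (hA : TorsionFree D A) : TorsionFree D (D.Twist 1 A) := by
  intro a ha
  rw [Twist.pi_eq] at ha
  exact hA a ha

theorem twist_poly_ext {σ : Type u} {x y : D.Witt n (D.Twist 1 (MvPolynomial σ R))}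
    (h : ∀ i, x.ghost i = y.ghost i) : x = y :=
  ghost_injective (torsionFree_twist (torsionFree_poly σ)) h

/-- The Frobenius `F : W_{n+1}(B) → W_n(B^φ)`, which is the left shift on ghost components. -/
def frob (D : FrobeniusBase O R) (n : ℕ) (B : Type u) [CommRing B] [Algebra R B] :
    D.Witt (n + 1) B →ₐ[R] D.Witt n (D.Twist 1 B) where
  toFun := frobFun
  map_zero' := by
    rw [← mapFun_zero (cover B), frobFun_mapFun, ← mapFun_zero (Twist.map 1 (cover B))]
    exact congrArg _ (twist_poly_ext fun i => by
      rw [ghost_frobFun, ghost_zero, ghost_zero]; rfl)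
  map_one' := by
    rw [← mapFun_one (cover B), frobFun_mapFun, ← mapFun_one (Twist.map 1 (cover B))]
    exact congrArg _ (twist_poly_ext fun i => by
      rw [ghost_frobFun, ghost_one, ghost_one]; rfl)
  map_add' x y := by
    obtain ⟨x, rfl⟩ := mapFun_cover_surjective x
    obtain ⟨y, rfl⟩ := mapFun_cover_surjective y
    simp only [← mapFun_add, frobFun_mapFun]
    exact congrArg _ (twist_poly_ext fun i => by
      rw [ghost_add, ghost_frobFun, ghost_frobFun, ghost_frobFun, ghost_add]; rfl)
  map_mul' x y := by
    obtain ⟨x, rfl⟩ := mapFun_cover_surjective x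
    obtain ⟨y, rfl⟩ := mapFun_cover_surjective y
    simp only [← mapFun_mul, frobFun_mapFun]
    exact congrArg _ (twist_poly_ext fun i => by
      rw [ghost_mul, ghost_frobFun, ghost_frobFun, ghost_frobFun, ghost_mul]; rfl)
  commutes' r := by
    have h1 : frobFun (expFun D (n + 1) r) = mapFun (Algebra.ofId R (D.Twist 1 R)) (expFun D n r) :=
      ghost_injective (torsionFree_twist torsionFree_base) fun i => by
        rw [ghost_frobFun, ghost_mapFun, ghost_expFun, ghost_expFun]
        change _ = (D.φ ^ 1) ((D.φ ^ (i : ℕ)) r)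
        rw [Fin.val_succ, pow_succ', pow_one]
        rfl
    change frobFun (mapFun (Algebra.ofId R B) (expFun D (n + 1) r)) =
      mapFun (Algebra.ofId R (D.Twist 1 B)) (expFun D n r)
    rw [frobFun_mapFun, h1, mapFun_comp]
    exact congrArg (fun f : R →ₐ[R] D.Twist 1 B => mapFun f (expFun D n r)) (Subsingleton.elim _ _)

theorem map_apply (f : A →ₐ[R] B) (x : D.Witt n A) : map f x = mapFun f x := rfl

theorem map_comp (f : A →ₐ[R] B) (g : B →ₐ[R] C) :
    (map g).comp (map f) = map (D := D) (n := n) (g.comp f) := rfl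

theorem trunc_comp_map {m : ℕ} (h : m ≤ n) (f : A →ₐ[R] B) :
    (trunc D h B).comp (map f) = (map f).comp (trunc D h A) := rfl

theorem frob_comp_map (f : A →ₐ[R] B) :
    (frob D n B).comp (map f) = (map (Twist.map 1 f)).comp (frob D n A) :=
  AlgHom.ext fun x => frobFun_mapFun f x

theorem trunc_comp_frob {m : ℕ} (h : m ≤ n) (h' : m + 1 ≤ n + 1) :
    (trunc D h (D.Twist 1 B)).comp (frob D n B) = (frob D m B).comp (trunc D h' B) := by
  refine AlgHom.ext fun x => ?_
  change truncFun h (frobFun x) = frobFun (truncFun h' x)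
  obtain ⟨x, rfl⟩ := mapFun_cover_surjective x
  rw [truncFun_mapFun, frobFun_mapFun, frobFun_mapFun, truncFun_mapFun]
  exact congrArg _ (twist_poly_ext fun i => by
    rw [ghost_truncFun, ghost_frobFun, ghost_frobFun, ghost_truncFun]; rfl)

end Witt

/-! ## Shifted Witt vectors -/

/-- The shifted Witt vectors `W_m(A) ×_{W_m(B)} W_{m+n}(B)` of an `R`-algebra homomorphism
`f : A → B`. For the structure map `R → B` this is the ring `W_{[m]n}(B)`, whose underlying set is
`R^{m+1} × B^n`; for the structure map regarded as a homomorphism `R^φ → B^φ` it is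
`W_{[m]n}(B^φ)`. -/
def ShiftedWitt (D : FrobeniusBase O R) (m n : ℕ) {A B : Type u} [CommRing A] [Algebra R A]
    [CommRing B] [Algebra R B] (f : A →ₐ[R] B) : Subalgebra R (D.Witt m A × D.Witt (n + m) B) :=
  AlgHom.equalizer ((Witt.map f).comp (AlgHom.fst R _ _))
    ((Witt.trunc D (Nat.le_add_left m n) B).comp (AlgHom.snd R _ _))

namespace ShiftedWitt

variable {D} {m n : ℕ} {A B : Type u} [CommRing A] [Algebra R A] [CommRing B] [Algebra R B]

/-- The projection `W_{[m]n}(B) → W_m(R)`, with kernel the Witt vectors supported in `B^n`. -/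
def toBase (D : FrobeniusBase O R) (m n : ℕ) (f : A →ₐ[R] B) :
    D.ShiftedWitt m n f →ₐ[R] D.Witt m A :=
  (AlgHom.fst R _ _).comp (D.ShiftedWitt m n f).val

/-- The natural map `I_{[m]n} : W_{[m]n}(B) → W_{m+n}(B)`. -/
def I (D : FrobeniusBase O R) (m n : ℕ) (f : A →ₐ[R] B) :
    D.ShiftedWitt m n f →ₐ[R] D.Witt (n + m) B :=
  (AlgHom.snd R _ _).comp (D.ShiftedWitt m n f).val

theorem map_comp_toBase (f : A →ₐ[R] B) :
    (Witt.map f).comp (toBase D m n f) =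
      (Witt.trunc D (Nat.le_add_left m n) B).comp (I D m n f) :=
  AlgHom.ext fun x => x.2

/-- The homomorphism `E_{[m+1]} : W_{[m+1]n}(B) → W_{[m]n}(B^φ)`, given on coordinates by the
Frobenius polynomials. -/
def E (D : FrobeniusBase O R) (m n : ℕ) (f : A →ₐ[R] B) :
    D.ShiftedWitt (m + 1) n f →ₐ[R] D.ShiftedWitt m n (Twist.map (D := D) 1 f) :=
  AlgHom.codRestrict
    (((Witt.frob D m A).comp (toBase D (m + 1) n f)).prod
      ((Witt.frob D (n + m) B).comp (I D (m + 1) n f))) _ fun x => by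
    have h1 := DFunLike.congr_fun (Witt.frob_comp_map (D := D) (n := m) f)
      (toBase D (m + 1) n f x)
    have h2 := DFunLike.congr_fun (map_comp_toBase (D := D) (m := m + 1) (n := n) f) x
    have h3 := DFunLike.congr_fun (Witt.trunc_comp_frob (D := D) (B := B)
      (Nat.le_add_left m n) (Nat.le_add_left (m + 1) n)) (I D (m + 1) n f x)
    exact h1.symm.trans ((congrArg (Witt.frob D m B) h2).trans h3.symm)

theorem toBase_comp_E (f : A →ₐ[R] B) :
    (toBase D m n (Twist.map 1 f)).comp (E D m n f) =
      (Witt.frob D m A).comp (toBase D (m + 1) n f) := rfl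

theorem I_comp_E (f : A →ₐ[R] B) :
    (I D m n (Twist.map 1 f)).comp (E D m n f) =
      (Witt.frob D (n + m) B).comp (I D (m + 1) n f) := rfl

end ShiftedWitt

/-! ## `π`-formal schemes -/

section Spf

variable {D} {A B C : Type u} [CommRing A] [Algebra R A] [CommRing B] [Algebra R B]
  [CommRing C] [Algebra R C]

/-- The system `Spec(B/π) → Spec(B/π²) → ⋯` of locally ringed spaces. -/
def spfDiagram (D : FrobeniusBase O R) (B : Type u) [CommRing B] [Algebra R B] :
    ℕ ⥤ LocallyRingedSpace.{u} where
  obj k := (Spec (.of (B ⧸ Ideal.span {D.pi B} ^ (k + 1)))).toLocallyRingedSpace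
  map {k l} h := (Spec.map (CommRingCat.ofHom (Ideal.Quotient.factor
    (Ideal.pow_le_pow_right (Nat.succ_le_succ (leOfHom h)))))).toLRSHom
  map_id k := by
    have : Ideal.Quotient.factor (le_refl (Ideal.span {D.pi B} ^ (k + 1))) = RingHom.id _ := by
      ext; rfl
    rw [this, CommRingCat.ofHom_id, Spec.map_id]
    rfl
  map_comp {k l j} h h' := by
    rw [← Scheme.Hom.comp_toLRSHom, ← Spec.map_comp, ← CommRingCat.ofHom_comp]
    congr 3
    ext; rfl

theorem span_pow_le_comap (f : A →ₐ[R] B) (k : ℕ) :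
    Ideal.span {D.pi A} ^ k ≤ (Ideal.span {D.pi B} ^ k).comap (f : A →+* B) := by
  rw [Ideal.span_singleton_pow, Ideal.span_singleton_pow, Ideal.span_singleton_le_iff_mem,
    Ideal.mem_comap]
  change f (D.pi A ^ k) ∈ _
  rw [map_pow, Witt.map_pi]
  exact Ideal.mem_span_singleton_self _

/-- The morphisms `Spec(B/π^k) → Spec(A/π^k)` induced by `f : A → B`. -/
def spfDiagramMap (D : FrobeniusBase O R) (f : A →ₐ[R] B) : D.spfDiagram B ⟶ D.spfDiagram A where
  app k := (Spec.map (CommRingCat.ofHom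
    (Ideal.quotientMap _ (f : A →+* B) (span_pow_le_comap (D := D) f (k + 1))))).toLRSHom
  naturality k l h := by
    dsimp only [spfDiagram]
    rw [← Scheme.Hom.comp_toLRSHom, ← Scheme.Hom.comp_toLRSHom, ← Spec.map_comp, ← Spec.map_comp,
      ← CommRingCat.ofHom_comp, ← CommRingCat.ofHom_comp]
    congr 3
    ext; rfl

theorem spfDiagramMap_id : D.spfDiagramMap (AlgHom.id R A) = 𝟙 _ := by
  ext k : 2
  have : Ideal.quotientMap _ ((AlgHom.id R A : A →ₐ[R] A) : A →+* A)
      (span_pow_le_comap (D := D) (AlgHom.id R A) (k + 1)) = RingHom.id _ := by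
    ext; rfl
  dsimp only [spfDiagramMap]
  rw [this, CommRingCat.ofHom_id, Spec.map_id]
  rfl

theorem spfDiagramMap_comp (f : A →ₐ[R] B) (g : B →ₐ[R] C) :
    D.spfDiagramMap (g.comp f) = D.spfDiagramMap g ≫ D.spfDiagramMap f := by
  refine NatTrans.ext (funext fun k => ?_)
  have h : CommRingCat.ofHom (Ideal.quotientMap _ ((g.comp f : A →ₐ[R] C) : A →+* C)
        (span_pow_le_comap (D := D) (g.comp f) (k + 1))) =
      CommRingCat.ofHom (Ideal.quotientMap _ (f : A →+* B)
        (span_pow_le_comap (D := D) f (k + 1))) ≫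
      CommRingCat.ofHom (Ideal.quotientMap _ (g : B →+* C)
        (span_pow_le_comap (D := D) g (k + 1))) := by
    rw [← CommRingCat.ofHom_comp]
    congr 1
    ext; rfl
  exact (congrArg Scheme.Hom.toLRSHom ((congrArg Spec.map h).trans (Spec.map_comp _ _))).trans
    (Scheme.Hom.comp_toLRSHom _ _)

/-- The formal spectrum `Spf B` for the `π`-adic topology of an `R`-algebra `B`, as a locally ringed
space: the colimit of the schemes `Spec(B/π^k)`. Its points are the prime ideals of `B` that contain
`π`, and its structure sheaf is the limit of the structure sheaves of the `Spec(B/π^k)`. -/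
abbrev Spf (D : FrobeniusBase O R) (B : Type u) [CommRing B] [Algebra R B] : LocallyRingedSpace.{u} :=
  Limits.colimit (D.spfDiagram B)

/-- The morphism `Spf B → Spf A` induced by `f : A → B`. -/
def spfMap (D : FrobeniusBase O R) (f : A →ₐ[R] B) : D.Spf B ⟶ D.Spf A :=
  Limits.colimMap (D.spfDiagramMap f)

theorem spfMap_id : D.spfMap (AlgHom.id R A) = 𝟙 _ := by
  refine Limits.colimit.hom_ext fun k => ?_
  rw [spfMap, Limits.ι_colimMap, spfDiagramMap_id]
  exact (Category.id_comp _).trans (Category.comp_id _).symm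

theorem spfMap_comp (f : A →ₐ[R] B) (g : B →ₐ[R] C) :
    D.spfMap (g.comp f) = D.spfMap g ≫ D.spfMap f := by
  refine Limits.colimit.hom_ext fun k => ?_
  rw [spfMap, spfMap, spfMap, Limits.ι_colimMap, spfDiagramMap_comp, Limits.ι_colimMap_assoc,
    Limits.ι_colimMap]
  exact Category.assoc _ _ _

/-- `Spf B` over `S = Spf R`. -/
def SpfOver (D : FrobeniusBase O R) (B : Type u) [CommRing B] [Algebra R B] : Over (D.Spf R) :=
  Over.mk (D.spfMap (Algebra.ofId R B))

/-- The morphism `Spf B → Spf A` over `S` induced by `f : A → B`. -/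
def spfOverMap (D : FrobeniusBase O R) (f : A →ₐ[R] B) : D.SpfOver B ⟶ D.SpfOver A :=
  Over.homMk (D.spfMap f) (by
    change D.spfMap f ≫ D.spfMap (Algebra.ofId R A) = D.spfMap (Algebra.ofId R B)
    rw [← spfMap_comp]
    congr 1
    exact Subsingleton.elim _ _)

theorem spfOverMap_id : D.spfOverMap (AlgHom.id R A) = 𝟙 _ :=
  Over.OverMorphism.ext spfMap_id

theorem spfOverMap_comp (f : A →ₐ[R] B) (g : B →ₐ[R] C) :
    D.spfOverMap (g.comp f) = D.spfOverMap g ≫ D.spfOverMap f :=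
  Over.OverMorphism.ext (spfMap_comp f g)

/-- A `π`-formal scheme over `S = Spf R`: a locally ringed space over `S` in which every point has
an open neighbourhood isomorphic over `S` to `Spf A` for a `π`-adically complete `R`-algebra `A`. -/
structure PiFormalScheme (D : FrobeniusBase O R) where
  /-- the locally ringed space with its structure morphism to `S` -/
  toOver : Over (D.Spf R)
  locally_affine : ∀ x : toOver.left, ∃ (U : Opens toOver.left) (A : CommAlgCat.{u} R),
    x ∈ U ∧ IsAdicComplete (Ideal.span {D.pi A}) A ∧
      Nonempty (Over.mk (toOver.left.ofRestrict U.isOpenEmbedding ≫ toOver.hom) ≅ D.SpfOver A)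

/-- The `R`-algebras that are `π`-adically complete. -/
def isComplete (D : FrobeniusBase O R) : ObjectProperty (CommAlgCat.{u} R) :=
  fun B => IsAdicComplete (Ideal.span {D.pi B}) B

/-- The category of `π`-adically complete `R`-algebras. -/
abbrev CompleteAlg (D : FrobeniusBase O R) := D.isComplete.FullSubcategory

/-- The functor `B ↦ B^φ`. For functors `Y`, `Z` of points over `S`, a morphism `Y → Z` over
`φ : S → S` is a natural transformation from `Y` to `B ↦ Z(B^φ)`. -/
def twist (D : FrobeniusBase O R) : D.CompleteAlg ⥤ D.CompleteAlg where
  obj B := ⟨.of R (D.Twist 1 B.obj), by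
    have h := B.property
    change IsAdicComplete (Ideal.span {D.pi (D.Twist 1 B.obj)}) (D.Twist 1 B.obj)
    rw [Twist.pi_eq]
    exact h⟩
  map f := ObjectProperty.homMk (CommAlgCat.ofHom (Twist.map 1 f.hom.hom))

end Spf

/-! ## Jet spaces, kernels and ghost maps -/

namespace PiFormalScheme

variable {D} (X : D.PiFormalScheme) {A B C : Type u} [CommRing A] [Algebra R A] [CommRing B]
  [Algebra R B] [CommRing C] [Algebra R C]

/-- `X(B) = Hom_S(Spf B, X)`. -/
def Points (B : Type u) [CommRing B] [Algebra R B] : Type u := D.SpfOver B ⟶ X.toOver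

/-- `X(f) : X(A) → X(B)` for `f : A → B`. -/
def map (f : A →ₐ[R] B) (x : X.Points A) : X.Points B := D.spfOverMap f ≫ x

theorem map_id (x : X.Points A) : X.map (AlgHom.id R A) x = x := by
  unfold map
  rw [spfOverMap_id]
  exact Category.id_comp _

theorem map_map (f : A →ₐ[R] B) (g : B →ₐ[R] C) (x : X.Points A) :
    X.map g (X.map f x) = X.map (g.comp f) x := by
  unfold map
  rw [spfOverMap_comp]
  exact (Category.assoc _ _ _).symm

/-- The marked point `P` as a point of `X` with values in an `R`-algebra. -/
def const (P : X.Points R) (B : Type u) [CommRing B] [Algebra R B] : X.Points B :=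
  X.map (Algebra.ofId R B) P

theorem map_const (P : X.Points R) (f : A →ₐ[R] B) : X.map f (X.const P A) = X.const P B := by
  unfold const
  rw [map_map]
  congr 1
  exact Subsingleton.elim _ _

theorem map_comm {A' : Type u} [CommRing A'] [Algebra R A'] {f : A →ₐ[R] B} {g : B →ₐ[R] C}
    {f' : A →ₐ[R] A'} {g' : A' →ₐ[R] C} (h : g.comp f = g'.comp f') (x : X.Points A) :
    X.map g (X.map f x) = X.map g' (X.map f' x) := by
  rw [map_map, map_map, h]

/-- The marked point `P^n ∈ J^nX(R) = X(W_n(R))`, the composite of `P` with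
`exp_δ : R → W_n(R)`. -/
def jetPoint (P : X.Points R) (n : ℕ) : X.Points (D.Witt n R) := X.map (Witt.exp D n) P

/-- The pullback of `P^n ∈ X(W_n(R))` to `X(W_n(B))`. -/
def jetPointAt (P : X.Points R) (n : ℕ) (B : Type u) [CommRing B] [Algebra R B] :
    X.Points (D.Witt n B) :=
  X.map (Witt.map (Algebra.ofId R B)) (X.jetPoint P n)

theorem jetPointAt_eq (P : X.Points R) (n : ℕ) (B : Type u) [CommRing B] [Algebra R B] :
    X.jetPointAt P n B = X.const P (D.Witt n B) := by
  unfold jetPointAt jetPoint const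
  rw [map_map]
  rfl

theorem hom_ext_types {α β : Type u} {f g : α ⟶ β} (h : ∀ x, f x = g x) : f = g :=
  ConcreteCategory.hom_ext _ _ h

/-- The jet space functor `J^nX`, `J^nX(B) = X(W_n(B))`. -/
def jet (n : ℕ) : D.CompleteAlg ⥤ Type u where
  obj B := X.Points (D.Witt n B.obj)
  map f := ↾fun g => X.map (Witt.map f.hom.hom) g
  map_id _ := hom_ext_types fun g => X.map_id g
  map_comp f f' := hom_ext_types fun g =>
    (X.map_map (Witt.map f.hom.hom) (Witt.map f'.hom.hom) g).symm

/-- The product `X × X^φ × ⋯ × X^{φ^n}` over `S`, where `X^{φ^i}(B) = X(B^{φ^i})`. -/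
def ghostProd (n : ℕ) : D.CompleteAlg ⥤ Type u where
  obj B := ∀ i : Fin (n + 1), X.Points (D.Twist i B.obj)
  map f := ↾fun z i => X.map (Twist.map i f.hom.hom) (z i)
  map_id _ := hom_ext_types fun z => funext fun i => X.map_id (z i)
  map_comp f f' := hom_ext_types fun z => funext fun i =>
    (X.map_map (Twist.map i f.hom.hom) (Twist.map i f'.hom.hom) (z i)).symm

/-- The ghost map `w : J^nX → X × X^φ × ⋯ × X^{φ^n}`. -/
def ghost (n : ℕ) : X.jet n ⟶ X.ghostProd n where
  app B := ↾fun g i => X.map (Witt.ghostHom D n B.obj i) g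
  naturality A B f := hom_ext_types fun g => funext fun i =>
    X.map_comm (f := Witt.map f.hom.hom) (g := Witt.ghostHom D n B.obj i)
      (f' := Witt.ghostHom D n A.obj i) (g' := Twist.map i f.hom.hom)
      (AlgHom.ext fun x => Witt.ghost_mapFun f.hom.hom x i) g

/-- The morphism `φ : J^{n+1}X → J^nX` over `φ : S → S` induced by `F : W_{n+1}(B) → W_n(B^φ)`. -/
def frob (n : ℕ) : X.jet (n + 1) ⟶ D.twist ⋙ X.jet n where
  app B := ↾fun g => X.map (Witt.frob D n B.obj) g
  naturality _ _ f := hom_ext_types fun g =>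
    X.map_comm (Witt.frob_comp_map f.hom.hom) g

/-- The `B`-points of the kernel `N^{[m]n}X = J^{m+n}X ×_{J^mX} S` of the projection
`u_m : J^{m+n}X → J^mX` at the marked point `P^m : S → J^mX`. Since `S(B)` is a single point, these
are the `g ∈ J^{m+n}X(B)` for which `u_m(g)` is the pullback of `P^m`. -/
def KernelPoints (P : X.Points R) (m n : ℕ) (B : Type u) [CommRing B] [Algebra R B] : Type u :=
  {g : X.Points (D.Witt (n + m) B) //
    X.map (Witt.trunc D (Nat.le_add_left m n) B) g = X.jetPointAt P m B}

/-- The kernel `N^{[m]n}X`. -/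
def kernel (P : X.Points R) (m n : ℕ) : D.CompleteAlg ⥤ Type u where
  obj B := X.KernelPoints P m n B.obj
  map f := ↾fun g => ⟨X.map (Witt.map f.hom.hom) g.1, by
    refine (X.map_comm (Witt.trunc_comp_map _ f.hom.hom) g.1).trans ?_
    rw [g.2, jetPointAt_eq, jetPointAt_eq, map_const]⟩
  map_id _ := hom_ext_types fun g => Subtype.ext (X.map_id g.1)
  map_comp f f' := hom_ext_types fun g => Subtype.ext
    (X.map_map (Witt.map f.hom.hom) (Witt.map f'.hom.hom) g.1).symm

/-- The ghost product `∏_{[m]n}X`, of points `⟨P, …, P, z_{m+1}, …, z_{m+n}⟩` with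
`z_i ∈ X^{φ^i}`. The `P` at the place `i ≤ m` is the pullback of the marked point to a point of
`X^{φ^i}`, that is, the composite `Spf B^{φ^i} → S → X`, with `Spf B → S` followed by `φ^i` as the
first map. -/
def ghostProdMarked (P : X.Points R) (m n : ℕ) : D.CompleteAlg ⥤ Type u where
  obj B := {z : ∀ i : Fin (n + m + 1), X.Points (D.Twist i B.obj) //
    ∀ i : Fin (n + m + 1), (i : ℕ) ≤ m → z i = X.const P (D.Twist i B.obj)}
  map f := ↾fun z => ⟨fun i => X.map (Twist.map i f.hom.hom) (z.1 i), fun i hi =>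
    (congrArg (X.map (Twist.map i f.hom.hom)) (z.2 i hi)).trans (X.map_const P _)⟩
  map_id _ := hom_ext_types fun z => Subtype.ext (funext fun i => X.map_id (z.1 i))
  map_comp f f' := hom_ext_types fun z => Subtype.ext (funext fun i =>
    (X.map_map (Twist.map i f.hom.hom) (Twist.map i f'.hom.hom) (z.1 i)).symm)

/-- The ghost map `w : N^{[m]n}X → ∏_{[m]n}X`, the restriction of `w` on `J^{m+n}X`. -/
def ghostKernel (P : X.Points R) (m n : ℕ) : X.kernel P m n ⟶ X.ghostProdMarked P m n where
  app B := ↾fun g => ⟨(X.ghost (n + m)).app B g.1, fun i hi => by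
    have h : Witt.ghostHom D (n + m) B.obj i =
        (Witt.ghostHom D m B.obj ⟨i, Nat.lt_succ_of_le hi⟩).comp
          (Witt.trunc D (Nat.le_add_left m n) B.obj) := AlgHom.ext fun x =>
      (Witt.ghost_truncFun (Nat.le_add_left m n) x ⟨i, Nat.lt_succ_of_le hi⟩).symm
    change X.map (Witt.ghostHom D (n + m) B.obj i) g.1 = _
    rw [h, ← map_map, g.2, jetPointAt_eq, map_const]⟩
  naturality A B f := hom_ext_types fun g => Subtype.ext (funext fun i =>
    X.map_comm (f := Witt.map f.hom.hom) (g := Witt.ghostHom D (n + m) B.obj i)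
      (f' := Witt.ghostHom D (n + m) A.obj i) (g' := Twist.map i f.hom.hom)
      (AlgHom.ext fun x => Witt.ghost_mapFun f.hom.hom x i) g.1)

/-- `Φ_[m+1]` on `B`-points, `N^{[m+1]n}X(B) → N^{[m]n}X(B^φ)`: the map of fibre products
`J^{m+1+n}X ×_{J^{m+1}X} S → J^{m+n}X ×_{J^mX} S` given by `φ`, that is, by the Frobenius
polynomials on coordinates. -/
def PhiFun (P : X.Points R) (m n : ℕ) {B : Type u} [CommRing B] [Algebra R B]
    (g : X.KernelPoints P (m + 1) n B) : X.KernelPoints P m n (D.Twist 1 B) :=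
  ⟨X.map (Witt.frob D (n + m) B) g.1, by
    refine (X.map_comm (Witt.trunc_comp_frob (Nat.le_add_left m n)
      (Nat.le_add_left (m + 1) n)) g.1).trans ?_
    refine (congrArg (X.map (Witt.frob D m B)) g.2).trans ?_
    rw [jetPointAt_eq, jetPointAt_eq, map_const]⟩

/-- The morphism `Φ_[m+1] : N^{[m+1]n}X → N^{[m]n}X` over `φ : S → S`. -/
def Phi (P : X.Points R) (m n : ℕ) : X.kernel P (m + 1) n ⟶ D.twist ⋙ X.kernel P m n where
  app B := ↾fun g => X.PhiFun (B := B.obj) P m n g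
  naturality _ _ f := hom_ext_types fun g =>
    Subtype.ext (X.map_comm (Witt.frob_comp_map f.hom.hom) g.1)

/-- `φ_S : X^{φ^(i+1)} → X^{φ^i}` over `φ : S → S`: on `B`-points, the identification of
`X^{φ^(i+1)}(B) = X(B^{φ^(i+1)})` with `X^{φ^i}(B^φ) = X((B^φ)^{φ^i})`. -/
def phiS (i : ℕ) {B : Type u} [CommRing B] [Algebra R B] (x : X.Points (D.Twist (i + 1) B)) :
    X.Points (D.Twist i (D.Twist 1 B)) :=
  X.map (Twist.shift D i B) x

/-- The morphism `Φ_{[m+1]w} : ∏_{[m+1]n}X → ∏_{[m]n}X` over `φ : S → S`,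
`⟨P, …, P, z_{m+2}, …, z_{m+1+n}⟩ ↦ ⟨φ_S(P), …, φ_S(P), φ_S(z_{m+2}), …, φ_S(z_{m+1+n})⟩`, with
`m + 2` entries `P` on the left and `m + 1` entries `φ_S(P)` on the right. -/
def PhiGhost (P : X.Points R) (m n : ℕ) :
    X.ghostProdMarked P (m + 1) n ⟶ D.twist ⋙ X.ghostProdMarked P m n where
  app B := ↾fun z => ⟨fun i : Fin (n + m + 1) => X.phiS (B := B.obj) i (z.1 i.succ), fun i hi =>
    (congrArg (X.phiS (B := B.obj) i) (z.2 i.succ (Nat.succ_le_succ hi))).trans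
      (X.map_const P (Twist.shift D i B.obj))⟩
  naturality A B f := hom_ext_types fun z => Subtype.ext (funext fun i =>
    X.map_comm (f := Twist.map (i + 1) f.hom.hom) (g := Twist.shift D i B.obj)
      (f' := Twist.shift D i A.obj) (g' := Twist.map i (Twist.map 1 f.hom.hom))
      (AlgHom.ext fun _ => rfl) (z.1 i.succ))

/-! ### Points with values in shifted Witt vectors -/

/-- The set `{g ∈ X(W_{[m]n}(B)) : g ∘ i_m = P^m}`, where `i_m : Spf W_m(R) → Spf W_{[m]n}(B)`, for
the structure map `R → B`; in general, the analogue for `f : A → B`. -/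
def ShiftedPoints (P : X.Points R) (m n : ℕ) (f : A →ₐ[R] B) : Type u :=
  {g : X.Points (D.ShiftedWitt m n f) //
    X.map (ShiftedWitt.toBase D m n f) g = X.jetPointAt P m A}

/-- The map on points with values in shifted Witt vectors induced by
`E_{[m+1]} : W_{[m+1]n}(B) → W_{[m]n}(B^φ)`. -/
def shiftedPhi (P : X.Points R) (m n : ℕ) (f : A →ₐ[R] B) (g : X.ShiftedPoints P (m + 1) n f) :
    X.ShiftedPoints P m n (Twist.map (D := D) 1 f) :=
  ⟨X.map (ShiftedWitt.E D m n f) g.1, by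
    rw [map_map, ShiftedWitt.toBase_comp_E, ← map_map, g.2, jetPointAt_eq, jetPointAt_eq,
      map_const]⟩

/-- The map to `N^{[m]n}X(B)` induced by `I_{[m]n} : W_{[m]n}(B) → W_{m+n}(B)`. -/
def ofShifted (P : X.Points R) (m n : ℕ) (f : A →ₐ[R] B)
    (g : X.ShiftedPoints P m n f) : X.KernelPoints P m n B :=
  ⟨X.map (ShiftedWitt.I D m n f) g.1, by
    rw [map_map, ← ShiftedWitt.map_comp_toBase, ← map_map, g.2, jetPointAt_eq, jetPointAt_eq,
      map_const]⟩

end PiFormalScheme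

end FrobeniusBase

end

/-! ### Frobenius and ghost components of Witt vectors -/

namespace FrobeniusBase.Witt

/-! Everything is a statement about homomorphisms of `R`-algebras, carried to points by
functoriality. A point of a jet space is a point of `X` with values in a ring of Witt vectors, and
all the maps involved ($\Phi_{[m]}$, the ghost components, $\phi_S$, $\iota_m$, the map induced by
$E_{[m]}$) are of the form `X.map h` on underlying points. Hence a commutative square of algebra
homomorphisms gives a commutative square of maps between points; this is `map_comm`. It needs
neither affine charts of $X$ nor representability of the jet spaces.

For the first claim the square is $w_i\circ F=w_{i+1}$. Its left side takes values in
$(B^\phi)^{\phi^i}$ and its right side in $B^{\phi^{i+1}}$. These are the same ring with the same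
structure map, and the identification `Twist.shift` between them is exactly what induces $\phi_S$ on
points. So the place $i$ of $w(\Phi_{[m]}(g))$ is $\phi_S$ of the place $i+1$ of $w(g)$, which is
the definition of $\Phi_{[m]w}$. The calculation is uniform in $i$. The marked places need no
separate treatment: that source and target are the right kernels and marked products is a condition
on points, checked when the maps are defined, and it does not affect equality.

For the second claim the square is $I\circ E=F\circ I$, where $I$ is the second projection of the
fibre product. It holds by construction, since $E$ is $F$ on each factor. What has content is that
$E$ lands in the fibre product at all: $F$ is natural in the algebra and commutes with truncation.

Lengths are written `n + m` and not `m + n` so that `n + (m + 1)` and `(n + m) + 1` agree by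
definition. Thus $F$ applies to points of the kernel at level `m + 1` without transport between Witt
vectors of propositionally equal lengths. -/

/-- The Frobenius is the left shift on ghost components, as an identity of homomorphisms of
`R`-algebras. -/
theorem ghostHom_comp_frob {O : Type v} {R : Type u} [CommRing O] [IsDedekindDomain O] [CommRing R]
    [IsDomain R] [IsDiscreteValuationRing R] [Algebra O R] (D : FrobeniusBase O R) (n : ℕ)
    (B : Type u) [CommRing B] [Algebra R B] (i : Fin (n + 1)) :
    (ghostHom D n (D.Twist 1 B) i).comp (frob D n B) =
      (Twist.shift D i B).comp (ghostHom D (n + 1) B i.succ) :=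
  -- `Twist.shift` is the identity on underlying rings, so only $w_i(F(x))=w_{i+1}(x)$ in $B$
  -- remains. This is a polynomial identity, valid even if $B$ has $\pi$-torsion: it holds for the
  -- generic Witt vector and specialises to $x$. Since $\phi(\pi)=\pi$, the ghost polynomials of
  -- $B^\phi$ and $B$ have the same coefficients.
  AlgHom.ext fun x => ghost_frobFun x i

end FrobeniusBase.Witt

/-! ### Transfer to points of the kernels -/

namespace FrobeniusBase.PiFormalScheme

variable {O : Type v} {R : Type u} [CommRing O] [IsDedekindDomain O] [CommRing R] [IsDomain R]
  [IsDiscreteValuationRing R] [Algebra O R] {D : FrobeniusBase O R} (X : D.PiFormalScheme)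

/-- The ghost components of `Φ_{[m+1]}(g)` are the images under `φ_S` of those of `g`. -/
theorem map_ghostHom_PhiFun (P : X.Points R) (m n : ℕ) {B : Type u} [CommRing B] [Algebra R B]
    (g : X.KernelPoints P (m + 1) n B) (i : Fin (n + m + 1)) :
    X.map (Witt.ghostHom D (n + m) (D.Twist 1 B) i) (X.PhiFun P m n g).1 =
      X.phiS i (X.map (Witt.ghostHom D (n + m + 1) B i.succ) g.1) :=
  -- The square of algebras is evaluated at the jet underlying `g`; the kernel condition `g.2` plays
  -- no role in the equality.
  X.map_comm (Witt.ghostHom_comp_frob D (n + m) B i) g.1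

/-- `Φ_{[m+1]}` on points with values in shifted Witt vectors. -/
theorem PhiFun_ofShifted (P : X.Points R) (m n : ℕ) {A B : Type u} [CommRing A] [Algebra R A]
    [CommRing B] [Algebra R B] (f : A →ₐ[R] B) (g : X.ShiftedPoints P (m + 1) n f) :
    X.PhiFun P m n (X.ofShifted P (m + 1) n f g) =
      X.ofShifted P m n (Twist.map 1 f) (X.shiftedPhi P m n f g) := by
  -- The kernel conditions are propositions, so it suffices to compare the underlying points with
  -- values in $W_{m+n}(B^\phi)$.
  refine Subtype.ext ?_
  change X.map (Witt.frob D (n + m) B) (X.map (ShiftedWitt.I D (m + 1) n f) g.1) =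
    X.map (ShiftedWitt.I D m n (Twist.map (D := D) 1 f)) (X.map (ShiftedWitt.E D m n f) g.1)
  -- Both sides come from one homomorphism $W_{[m+1]n}(f)\to W_{m+n}(B^\phi)$: project to the second
  -- factor and apply $F$, or apply $E$ and then project.
  exact X.map_comm (ShiftedWitt.I_comp_E (D := D) (m := m) (n := n) f).symm g.1

end FrobeniusBase.PiFormalScheme

/-! ### The two claims -/

/-- The index is shifted: `m + 1` here is the $m\ge 1$ of the claim. A morphism over $\phi$ is a
transformation into a functor precomposed with `D.twist`, so $w$ applied after $\Phi$ is evaluated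
at $B^\phi$; this is the whiskering on the left. In the second part the target is formed with
$R^\phi\to B^\phi$, whose first factor is $W_m(R^\phi)$, and not with the structure map $R\to
B^\phi$. This is why shifted Witt vectors are treated for an arbitrary $f:A\to B$, a class closed
under twisting. -/
theorem mainTheorem6 {O : Type v} {R : Type u} [CommRing O] [IsDedekindDomain O] [CommRing R]
    [IsDomain R] [IsDiscreteValuationRing R] [Algebra O R] (D : FrobeniusBase O R)
    (X : D.PiFormalScheme) (P : X.Points R) (m n : ℕ) :
    X.Phi P m n ≫ Functor.whiskerLeft D.twist (X.ghostKernel P m n) =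
        X.ghostKernel P (m + 1) n ≫ X.PhiGhost P m n ∧
      ∀ (B : D.CompleteAlg) (g : X.ShiftedPoints P (m + 1) n (Algebra.ofId R B.obj)),
        (X.Phi P m n).app B (X.ofShifted P (m + 1) n (Algebra.ofId R B.obj) g) =
          X.ofShifted P m n (FrobeniusBase.Twist.map 1 (Algebra.ofId R B.obj))
            (X.shiftedPhi P m n (Algebra.ofId R B.obj) g) := by
  constructor
  · refine NatTrans.ext (funext fun B => FrobeniusBase.PiFormalScheme.hom_ext_types fun g => ?_)
    -- Here `i` runs over the places $0,\dots,m+n$ of the target. It is matched with the place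
    -- `i.succ` of the source, so place $0$ of the source is dropped and one marked entry
    -- disappears.
    refine Subtype.ext (funext fun i => ?_)
    exact X.map_ghostHom_PhiFun P m n (B := B.obj) g i
  · exact fun B g => X.PhiFun_ofShifted P m n (Algebra.ofId R B.obj) g
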